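/- Let $d\ge 2$. By a convex body in $\mathbb{R}^d$ we understand a compact convex subset of $\mathbb{R}^d$ with non-empty interior. For a convex body $K\subset\mathbb{R}^d$ with volume $|K|$, let $$\Delta(K)=\frac{1}{|K|^2}\int_K\int_K|\mathbf{x}-\mathbf{y}|\,d\mathbf{x}\,d\mathbf{y}$$ be the mean Euclidean distance of two independent uniformly distributed random points in $K$, and let $\mathrm{diam}(K)$ be the Euclidean diameter of $K$. Then every convex body $K\subset\mathbb{R}^d$ satisfies $$\frac{3d+1}{2(d+1)(2d+1)}<\frac{\Delta(K)}{\mathrm{diam}(K)}<\frac{\sqrt{\pi}}{3}\,\frac{\Gamma\left(\frac{d+1}{2}\right)}{\Gamma\left(\frac{d}{2}\right)}.$$ Moreover, the lower bound is sharp: if $e_1,\dots,e_d$ is the standard orthonormal basis of $\mathbb{R}^d$, then for every $\delta>0$ the set $K_\delta=\mathrm{conv}(e_1,-e_1,\delta e_2,\dots,\delta e_d)$ is a convex body, and $$\lim_{\delta\downarrow 0}\frac{\Delta(K_\delta)}{\mathrm{diam}(K_\delta)}=\frac{3d+1}{2(d+1)(2d+1)}.$$ -/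

import Mathlib

open MeasureTheory Filter Topology

/-- A convex body in `ℝ^d`: a compact convex set with non-empty interior. -/
structure IsConvexBody {d : ℕ} (K : Set (EuclideanSpace ℝ (Fin d))) : Prop where
  isCompact : IsCompact K
  convex : Convex ℝ K
  interior_nonempty : (interior K).Nonempty

/-- The mean distance `Δ(K) = |K|⁻² ∫_K ∫_K |x - y| dx dy`: the expected Euclidean distance of two
independent uniformly distributed random points of `K`. -/
noncomputable def meanDistance {d : ℕ} (K : Set (EuclideanSpace ℝ (Fin d))) : ℝ :=
  (1 / (volume.real K) ^ 2) * ∫ x in K, ∫ y in K, ‖x - y‖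

/-- `K_δ = conv(e₁, -e₁, δ e₂, …, δ e_d)`; the coordinate indices start at `0` here. -/
noncomputable def thinSimplex (d : ℕ) [NeZero d] (δ : ℝ) : Set (EuclideanSpace ℝ (Fin d)) :=
  convexHull ℝ
    ({EuclideanSpace.single 0 1, -EuclideanSpace.single 0 1} ∪
      {x | ∃ i : Fin d, i ≠ 0 ∧ x = δ • EuclideanSpace.single i 1})

/-!
**Lower bound.** Let `a, b ∈ K` be at distance `D = diam K`, let `u` be the unit vector from `a`
to `b`, and let `p x = ⟪u, x - a⟫`, which takes values in `[0, D]` on `K`. Since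
`‖x - y‖ ≥ |p x - p y|`, strictly on an open set because `d ≥ 2`, it suffices to bound the mean
of `|p x - p y|`. With `F t = vol {x ∈ K | p x ≤ t}` and `V = vol K`, its integral over `K × K`
is `2 ∫₀ᴰ F (V - F)` (`integral_integral_abs_sub_eq`). As `K` is star-shaped about `a` and about
`b`, homotheties centred there show that `F t / t ^ d` decreases and `(V - F t) / (D - t) ^ d`
increases. Comparison at the median with the double cone then gives the sharp constant
(`double_cone_le_integral_mul_sub`); no concavity of section volumes, hence no Brunn–Minkowski
inequality, is needed.

**Upper bound.** The stronger bound `Δ(K) ≤ d / (d + 2) * diam K` holds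
(`integral_norm_sub_le_diam`). The difference of two random points has density proportional to
the covariogram `g z = vol (K ∩ (K - z))`, which is convex along rays from the origin and
vanishes beyond the diameter `D`. In polar coordinates the mean of `‖z‖` with weight `g` is
therefore at most the mean of the density proportional to `r ^ (d - 1) * (D - r)`, and that is
`d / (d + 2) * D`. Log-convexity of the Gamma function gives
`Γ((d + 1) / 2) / Γ(d / 2) ≥ √((d - 1) / 2)`, which is enough to compare the constants for
`d ≥ 4`; the cases `d = 2, 3` are computed.

**Sharpness.** On the thin simplex the first coordinate has exactly the double cone distribution,
and the other coordinates change the distance of two points by at most `d * δ`.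
-/

open Set Module
open scoped RealInnerProductSpace

/-! ### Homotheties, hyperplanes and distribution functions -/

/-- A homothety of ratio `r` scales volume by `r ^ dim`, so it bounds from below the volume of
any set that contains the image. For a set star-shaped about the center this compares its
truncations. -/
theorem pow_mul_measureReal_le_of_mapsTo_homothety {E : Type*} [NormedAddCommGroup E]
    [NormedSpace ℝ E] [FiniteDimensional ℝ E] [MeasurableSpace E] [BorelSpace E] (μ : Measure E)
    [μ.IsAddHaarMeasure] {A B : Set E} {a : E} {r : ℝ} (hr : 0 ≤ r) (hB : μ B ≠ ⊤)
    (h : MapsTo (AffineMap.homothety a r) A B) :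
    r ^ finrank ℝ E * μ.real A ≤ μ.real B := by
  have h1 : μ.real (AffineMap.homothety a r '' A) ≤ μ.real B :=
    measureReal_mono h.image_subset hB
  rwa [measureReal_def, Measure.addHaar_image_homothety, ENNReal.toReal_mul,
    ENNReal.toReal_ofReal (abs_nonneg _), abs_of_nonneg (by positivity)] at h1

theorem measure_inner_eq_zero {E : Type*} [NormedAddCommGroup E] [InnerProductSpace ℝ E]
    [FiniteDimensional ℝ E] [MeasurableSpace E] [BorelSpace E] (μ : Measure E)
    [μ.IsAddHaarMeasure] {u : E} (hu : u ≠ 0) (c : ℝ) : μ {x | ⟪u, x⟫ = c} = 0 := by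
  obtain ⟨x₀, hx₀⟩ : ∃ x₀ : E, ⟪u, x₀⟫ = c := by
    refine ⟨(c / ⟪u, u⟫) • u, ?_⟩
    rw [inner_smul_right, div_mul_cancel₀]
    simpa using hu
  have h1 : μ ((ℝ ∙ u)ᗮ : Submodule ℝ E) = 0 := by
    apply Measure.addHaar_submodule
    intro h
    have h2 : u ∈ (ℝ ∙ u)ᗮ := by rw [h]; trivial
    rw [Submodule.mem_orthogonal_singleton_iff_inner_right] at h2
    exact hu (by simpa using h2)
  have h2 : {x | ⟪u, x⟫ = c} = (fun x => x + (-x₀)) ⁻¹' ((ℝ ∙ u)ᗮ : Submodule ℝ E) := by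
    ext x
    simp only [mem_ofPred_eq, mem_preimage, SetLike.mem_coe,
      Submodule.mem_orthogonal_singleton_iff_inner_right, inner_add_right, inner_neg_right, hx₀]
    constructor <;> intro h <;> linarith
  rw [h2, measure_preimage_add_right, h1]

/-- The Gini mean difference: for a distribution on `[0, D]`, the mean of `|p x - p y|` is twice
the integral of `F (V - F)`, where `F` is the unnormalized distribution function of `p` and `V`
the total mass. This is Fubini for the event that the level `t` separates `p x` from `p y`. -/
theorem integral_integral_abs_sub_eq {α : Type*} [MeasurableSpace α] (ν : Measure α)
    [IsFiniteMeasure ν] {p : α → ℝ} (hp : Measurable p) {D : ℝ} (hD : 0 ≤ D)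
    (hpD : ∀ᵐ x ∂ν, p x ∈ Icc 0 D) :
    ∫ x, ∫ y, |p x - p y| ∂ν ∂ν =
      2 * ∫ t in 0..D, ν.real {x | p x ≤ t} * (ν.real univ - ν.real {x | p x ≤ t}) := by
  have hint : Integrable p ν := by
    refine Integrable.of_bound hp.aestronglyMeasurable D ?_
    filter_upwards [hpD] with x hx
    rw [Real.norm_eq_abs, abs_of_nonneg hx.1]
    exact hx.2
  set τ := (volume : Measure ℝ).restrict (Ioc 0 D) with hτ
  -- the indicator of the event that the level `t` separates `p x` from `p y`
  set A : Set ((α × α) × ℝ) := {z | p z.1.1 ≤ z.2 ∧ z.2 < p z.1.2} with hA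
  set B : Set ((α × α) × ℝ) := {z | p z.1.2 ≤ z.2 ∧ z.2 < p z.1.1} with hB
  have p1 : Measurable fun z : (α × α) × ℝ => p z.1.1 := by fun_prop
  have p2 : Measurable fun z : (α × α) × ℝ => p z.1.2 := by fun_prop
  have mA : MeasurableSet A :=
    (measurableSet_le p1 measurable_snd).inter (measurableSet_lt measurable_snd p2)
  have mB : MeasurableSet B :=
    (measurableSet_le p2 measurable_snd).inter (measurableSet_lt measurable_snd p1)
  have iA : Integrable (A.indicator (fun _ => (1 : ℝ))) ((ν.prod ν).prod τ) :=
    (integrable_const 1).indicator mA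
  have iB : Integrable (B.indicator (fun _ => (1 : ℝ))) ((ν.prod ν).prod τ) :=
    (integrable_const 1).indicator mB
  have hV : ∀ t, ν.real {x | t < p x} = ν.real univ - ν.real {x | p x ≤ t} := by
    intro t
    have m1 : MeasurableSet {x | p x ≤ t} := hp measurableSet_Iic
    rw [← measureReal_compl m1]
    congr 1
    ext x; simp
  have h1 : ∫ x, ∫ y, |p x - p y| ∂ν ∂ν = ∫ z, |p z.1 - p z.2| ∂(ν.prod ν) := by
    rw [integral_prod]
    exact ((hint.comp_fst ν).sub (hint.comp_snd ν)).abs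
  have h2 : ∫ z, |p z.1 - p z.2| ∂(ν.prod ν) = ∫ z, ∫ t, (A.indicator (fun _ => (1 : ℝ)) (z, t)
      + B.indicator (fun _ => (1 : ℝ)) (z, t)) ∂τ ∂(ν.prod ν) := by
    refine integral_congr_ae ?_
    have q1 : ∀ᵐ z ∂(ν.prod ν), p z.1 ∈ Icc 0 D :=
      Measure.quasiMeasurePreserving_fst.ae hpD
    have q2 : ∀ᵐ z ∂(ν.prod ν), p z.2 ∈ Icc 0 D :=
      Measure.quasiMeasurePreserving_snd.ae hpD
    have key : ∀ a b : ℝ, a ∈ Icc 0 D → b ∈ Icc 0 D →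
        ∫ t, (Ico a b).indicator (fun _ => (1 : ℝ)) t ∂τ = max (b - a) 0 := by
      intro a b ha hb
      rw [integral_indicator measurableSet_Ico, hτ, Measure.restrict_restrict measurableSet_Ico,
        setIntegral_const, smul_eq_mul, mul_one]
      have : (Ico a b ∩ Ioc 0 D : Set ℝ) =ᵐ[volume] Ico a b := by
        have e1 : (Ioc a b ∩ Ioc 0 D : Set ℝ) = Ioc a b :=
          inter_eq_left.2 (Ioc_subset_Ioc ha.1 hb.2)
        have e2 : (Ico a b : Set ℝ) =ᵐ[volume] Ioc a b := Ico_ae_eq_Ioc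
        have e3 := e2.inter (ae_eq_refl (μ := volume) (Ioc 0 D : Set ℝ))
        rw [e1] at e3
        exact e3.trans e2.symm
      rw [measureReal_congr this, Real.volume_real_Ico]
    filter_upwards [q1, q2] with z hz1 hz2
    have e1 : ∀ t, A.indicator (fun _ => (1 : ℝ)) (z, t) =
        (Ico (p z.1) (p z.2)).indicator (fun _ => (1 : ℝ)) t := by
      intro t; rfl
    have e2 : ∀ t, B.indicator (fun _ => (1 : ℝ)) (z, t) =
        (Ico (p z.2) (p z.1)).indicator (fun _ => (1 : ℝ)) t := by
      intro t; rfl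
    simp only [e1, e2]
    rw [integral_add ((integrable_const 1).indicator measurableSet_Ico)
      ((integrable_const 1).indicator measurableSet_Ico), key _ _ hz1 hz2, key _ _ hz2 hz1]
    rcases le_total (p z.1) (p z.2) with h | h
    · rw [max_eq_left (by linarith), max_eq_right (by linarith), abs_of_nonpos (by linarith)]; ring
    · rw [max_eq_right (by linarith), max_eq_left (by linarith), abs_of_nonneg (by linarith)]; ring
  rw [h1, h2, integral_integral_swap (iA.add iB), intervalIntegral.integral_of_le hD,
    ← integral_const_mul]
  refine integral_congr_ae (Eventually.of_forall fun t => ?_)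
  have e1 : ∀ z : α × α, A.indicator (fun _ => (1 : ℝ)) (z, t) =
      ({x | p x ≤ t} ×ˢ {x | t < p x}).indicator (fun _ => (1 : ℝ)) z := by
    intro z; rfl
  have e2 : ∀ z : α × α, B.indicator (fun _ => (1 : ℝ)) (z, t) =
      ({x | t < p x} ×ˢ {x | p x ≤ t}).indicator (fun _ => (1 : ℝ)) z := by
    intro z
    simp only [hB, indicator, mem_ofPred_eq, mem_prod]
    congr 1
    simp [and_comm]
  have m1 : MeasurableSet {x | p x ≤ t} := hp measurableSet_Iic
  have m2 : MeasurableSet {x | t < p x} := hp measurableSet_Ioi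
  simp only [e1, e2]
  rw [integral_add ((integrable_const 1).indicator (m1.prod m2))
    ((integrable_const 1).indicator (m2.prod m1)), integral_indicator_const _ (m1.prod m2),
    integral_indicator_const _ (m2.prod m1), measureReal_prod_prod, measureReal_prod_prod, hV]
  simp only [smul_eq_mul]
  ring

/-- A distribution function without atoms is continuous. -/
theorem continuous_measureReal_sublevel {α : Type*} [MeasurableSpace α] (ν : Measure α)
    [IsFiniteMeasure ν] {p : α → ℝ} (hp : Measurable p) (h0 : ∀ t, ν {x | p x = t} = 0) :
    Continuous fun t => ν.real {x | p x ≤ t} := by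
  have h1 : (fun t => ν.real {x | p x ≤ t}) =
      fun t => ∫ x, {x | p x ≤ t}.indicator (fun _ => (1 : ℝ)) x ∂ν := by
    funext t
    have m1 : MeasurableSet {x | p x ≤ t} := hp measurableSet_Iic
    rw [integral_indicator_const _ m1, smul_eq_mul, mul_one]
  rw [h1, continuous_iff_continuousAt]
  intro t
  refine continuousAt_of_dominated (bound := fun _ => 1) ?_ ?_ (integrable_const _) ?_
  · exact Eventually.of_forall fun s =>
      (measurable_const.indicator (hp measurableSet_Iic)).aestronglyMeasurable
  · refine Eventually.of_forall fun s => Eventually.of_forall fun x => ?_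
    by_cases h : p x ≤ s <;> simp [indicator, h]
  · have h2 : ∀ᵐ x ∂ν, p x ≠ t := by
      rw [ae_iff]
      simpa using h0 t
    filter_upwards [h2] with x hx
    rcases lt_or_gt_of_ne hx with h | h
    · refine (continuousAt_const (y := (1 : ℝ))).congr ?_
      filter_upwards [lt_mem_nhds h] with s hs
      simp [indicator, hs.le]
    · refine (continuousAt_const (y := (0 : ℝ))).congr ?_
      filter_upwards [gt_mem_nhds h] with s hs
      simp [indicator, hs]

/-! ### The extremal property of the double cone -/

/-- The function `t ↦ V / 2 * (t / m) ^ d` is the volume of `{p ≤ t}` for a cone of height `m`,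
apex at level `0` and volume `V / 2`, that is, for one half of a double cone of volume `V`. -/
theorem integral_double_cone_profile (d : ℕ) (V : ℝ) {m : ℝ} (hm : 0 < m) :
    ∫ t in 0..m, V / 2 * (t / m) ^ d * (V - V / 2 * (t / m) ^ d) =
      (3 * (d : ℝ) + 1) / (4 * ((d : ℝ) + 1) * (2 * (d : ℝ) + 1)) * m * V ^ 2 := by
  have h1 : ∀ t : ℝ, V / 2 * (t / m) ^ d * (V - V / 2 * (t / m) ^ d) =
      V ^ 2 / (2 * m ^ d) * t ^ d - V ^ 2 / (4 * m ^ (2 * d)) * t ^ (2 * d) := by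
    intro t
    rw [div_pow, two_mul d, pow_add, pow_add]
    field_simp
    ring
  simp only [h1]
  rw [intervalIntegral.integral_sub (Continuous.intervalIntegrable (by fun_prop) _ _)
      (Continuous.intervalIntegrable (by fun_prop) _ _),
    intervalIntegral.integral_const_mul, intervalIntegral.integral_const_mul, integral_pow,
    integral_pow]
  simp only [pow_succ, mul_zero, sub_zero]
  push_cast
  field_simp
  ring

theorem mul_sub_le_mul_sub_of_le_half {V a b : ℝ} (hab : a ≤ b) (hb : b ≤ V / 2) :
    a * (V - a) ≤ b * (V - b) := by
  nlinarith [mul_nonneg (sub_nonneg.2 hab) (by linarith : 0 ≤ V - a - b)]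

/-- Among the distribution functions that satisfy the homothety bounds `h1` (seen from the end
`0`) and `h2` (seen from the end `D`), the double cone minimizes `∫ F (V - F)`. Split `[0, D]`
at the median `m`: left of it `F ≤ V / 2` is at least `V / 2 * (t / m) ^ d`, right of it the
same holds for `V - F` with the roles of the ends exchanged, and `s ↦ s (V - s)` increases on
`[0, V / 2]`. The two parts contribute amounts proportional to `m` and `D - m`, so the position
of the median drops out. -/
theorem double_cone_le_integral_mul_sub (d : ℕ) {F : ℝ → ℝ} {V D : ℝ} (hV : 0 < V) (hD : 0 < D)
    (hF : Continuous F) (hmono : Monotone F) (hF0 : F 0 = 0) (hFD : F D = V)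
    (h1 : ∀ s t, 0 < s → s ≤ D → 0 ≤ t → t ≤ s → (t / s) ^ d * F s ≤ F t)
    (h2 : ∀ s t, 0 ≤ s → s < D → s ≤ t → t ≤ D →
      ((D - t) / (D - s)) ^ d * (V - F s) ≤ V - F t) :
    (3 * (d : ℝ) + 1) / (4 * ((d : ℝ) + 1) * (2 * (d : ℝ) + 1)) * D * V ^ 2 ≤
      ∫ t in 0..D, F t * (V - F t) := by
  obtain ⟨m, ⟨hm0, hmD⟩, hm⟩ : ∃ m ∈ Icc 0 D, F m = V / 2 := by
    have := intermediate_value_Icc hD.le hF.continuousOn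
    exact this ⟨by rw [hF0]; linarith, by rw [hFD]; linarith⟩
  have hm0 : 0 < m := lt_of_le_of_ne hm0 (by rintro rfl; linarith)
  have hmD : m < D := lt_of_le_of_ne hmD (by rintro rfl; linarith)
  have hc : Continuous fun t => F t * (V - F t) := by fun_prop
  have left : ∫ t in 0..m, V / 2 * (t / m) ^ d * (V - V / 2 * (t / m) ^ d) ≤
      ∫ t in 0..m, F t * (V - F t) := by
    refine intervalIntegral.integral_mono_on hm0.le
      (Continuous.intervalIntegrable (by fun_prop) _ _) (hc.intervalIntegrable _ _) fun t ht => ?_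
    refine mul_sub_le_mul_sub_of_le_half ?_ (hm ▸ hmono ht.2)
    rw [mul_comm, ← hm]
    exact h1 m t hm0 hmD.le ht.1 ht.2
  have right : ∫ t in 0..(D - m), V / 2 * (t / (D - m)) ^ d * (V - V / 2 * (t / (D - m)) ^ d) ≤
      ∫ t in m..D, F t * (V - F t) := by
    have e := intervalIntegral.integral_comp_sub_left (a := 0) (b := D - m)
      (fun t => F t * (V - F t)) D
    simp only [sub_sub_cancel, sub_zero] at e
    rw [← e]
    refine intervalIntegral.integral_mono_on (by linarith)
      (Continuous.intervalIntegrable (by fun_prop) _ _)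
      (Continuous.intervalIntegrable (by fun_prop) _ _) fun t ht => ?_
    have hle : m ≤ D - t := by linarith [ht.2]
    have k1 := h2 m (D - t) hm0.le hmD hle (by linarith [ht.1])
    rw [sub_sub_cancel, hm] at k1
    have k2 := hmono hle
    have k3 := mul_sub_le_mul_sub_of_le_half (V := V) (a := V / 2 * (t / (D - m)) ^ d)
      (b := V - F (D - t)) (by linarith) (by linarith)
    linarith
  rw [integral_double_cone_profile d V hm0] at left
  rw [integral_double_cone_profile d V (sub_pos.2 hmD)] at right
  rw [← intervalIntegral.integral_add_adjacent_intervals (hc.intervalIntegrable 0 m)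
    (hc.intervalIntegrable m D)]
  linarith

/-! ### The lower bound -/

theorem measureReal_sub_restrict_sublevel {α : Type*} [MeasurableSpace α] (μ : Measure α)
    {K : Set α} (hK : μ K ≠ ⊤) {p : α → ℝ} (hp : Measurable p) {t : ℝ}
    (h0 : μ {x | p x = t} = 0) :
    μ.real K - (μ.restrict K).real {x | p x ≤ t} = μ.real ({x | t ≤ p x} ∩ K) := by
  have hfin : IsFiniteMeasure (μ.restrict K) := ⟨by
    rw [Measure.restrict_apply_univ]; exact hK.lt_top⟩
  have m1 : MeasurableSet {x | p x ≤ t} := hp measurableSet_Iic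
  have m2 : MeasurableSet {x | t ≤ p x} := hp measurableSet_Ici
  rw [← measureReal_restrict_apply_univ, ← measureReal_compl m1,
    ← measureReal_restrict_apply m2]
  refine measureReal_congr (eventuallyEq_set.2 ?_)
  have h3 : ∀ᵐ x ∂μ, p x ≠ t := by
    rw [ae_iff]; simpa using h0
  filter_upwards [ae_restrict_of_ae h3] with x hx
  simp only [mem_compl_iff, mem_ofPred_eq, not_le]
  exact ⟨fun h => h.le, fun h => lt_of_le_of_ne h (Ne.symm hx)⟩

section Projection

variable {E : Type*} [NormedAddCommGroup E] [InnerProductSpace ℝ E] [FiniteDimensional ℝ E]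
  [MeasurableSpace E] [BorelSpace E] (μ : Measure E) [μ.IsAddHaarMeasure]

/-- The lower bound for the projections onto the line of a segment `[a, a + D u] ⊆ K` that spans
the whole width of `K` in direction `u`. -/
theorem double_cone_le_integral_abs_inner {K : Set E} (hK : IsCompact K) (hc : Convex ℝ K)
    (hV : 0 < μ.real K) {a u : E} {D : ℝ} (hD : 0 < D) (hu : ‖u‖ = 1) (ha : a ∈ K)
    (hb : a + D • u ∈ K) (hp : ∀ x ∈ K, ⟪u, x - a⟫ ∈ Icc 0 D) :
    (3 * (finrank ℝ E : ℝ) + 1) / (2 * ((finrank ℝ E : ℝ) + 1) * (2 * (finrank ℝ E : ℝ) + 1)) * D *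
      μ.real K ^ 2 ≤ ∫ x in K, ∫ y in K, |⟪u, x - y⟫| ∂μ ∂μ := by
  set d := finrank ℝ E
  set V := μ.real K
  have hfin : IsFiniteMeasure (μ.restrict K) := ⟨by
    rw [Measure.restrict_apply_univ]; exact hK.measure_lt_top⟩
  have hu0 : u ≠ 0 := by rintro rfl; simp at hu
  have huu : ⟪u, u⟫ = 1 := by rw [real_inner_self_eq_norm_sq, hu]; norm_num
  set p : E → ℝ := fun x => ⟪u, x - a⟫ with hpdef
  have hpm : Measurable p := Continuous.measurable (by fun_prop)
  have hnull : ∀ t, μ {x | p x = t} = 0 := by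
    intro t
    rw [← measure_inner_eq_zero μ hu0 (t + ⟪u, a⟫)]
    congr 1
    ext x
    simp [hpdef, inner_sub_right, sub_eq_iff_eq_add]
  set F : ℝ → ℝ := fun t => (μ.restrict K).real {x | p x ≤ t} with hFdef
  have hFK : ∀ t, F t = μ.real ({x | p x ≤ t} ∩ K) := fun t => by
    have m1 : MeasurableSet {x | p x ≤ t} := hpm measurableSet_Iic
    simp only [hFdef]
    rw [measureReal_restrict_apply m1]
  have hVK : (μ.restrict K).real univ = V := by simp [V]
  have hfinite : ∀ s : Set E, μ (s ∩ K) ≠ ⊤ := fun s =>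
    ((measure_mono inter_subset_right).trans_lt hK.measure_lt_top).ne
  have hWK : ∀ t, V - F t = μ.real ({x | t ≤ p x} ∩ K) := fun t =>
    measureReal_sub_restrict_sublevel μ hK.measure_lt_top.ne hpm (hnull t)
  have hhom : ∀ (c x : E) (r : ℝ), p (AffineMap.homothety c r x) = r * (p x - p c) + p c := by
    intro c x r
    simp only [hpdef, AffineMap.homothety_apply, vsub_eq_sub, vadd_eq_add, add_sub_assoc,
      inner_add_right, inner_smul_right, ← inner_sub_right, sub_sub_sub_cancel_right]
  have hpa : p a = 0 := by simp [hpdef]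
  have hpb : p (a + D • u) = D := by simp [hpdef, inner_smul_right, hu]
  have hstar : ∀ c ∈ K, ∀ x ∈ K, ∀ r : ℝ, 0 ≤ r → r ≤ 1 → AffineMap.homothety c r x ∈ K := by
    intro c hcK x hx r h0 h1
    rw [AffineMap.homothety_eq_lineMap]
    exact hc.lineMap_mem hcK hx ⟨h0, h1⟩
  have hpD : ∀ᵐ x ∂(μ.restrict K), p x ∈ Icc 0 D := by
    filter_upwards [ae_restrict_mem hK.measurableSet] with x hx using hp x hx
  have key := double_cone_le_integral_mul_sub d (F := F) (V := V) (D := D) hV hD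
    (continuous_measureReal_sublevel _ hpm fun t =>
      le_antisymm ((Measure.restrict_apply_le _ _).trans (hnull t).le) bot_le)
    (fun s t hst => measureReal_mono fun x hx => le_trans hx hst)
    ?_ ?_ ?_ ?_
  · have h := integral_integral_abs_sub_eq (μ.restrict K) hpm hD.le hpD
    rw [hVK] at h
    have e : ∀ x y, |⟪u, x - y⟫| = |p x - p y| := by
      intro x y
      simp only [hpdef, ← inner_sub_right, sub_sub_sub_cancel_right]
    simp only [e]
    rw [h]
    refine le_trans (le_of_eq ?_) (mul_le_mul_of_nonneg_left key (by norm_num : (0 : ℝ) ≤ 2))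
    field_simp
    ring
  · rw [hFK, measureReal_def, measure_mono_null (fun x hx => ?_) (hnull 0), ENNReal.toReal_zero]
    exact le_antisymm hx.1 (hp x hx.2).1
  · rw [hFK]
    congr 1
    exact inter_eq_right.2 fun x hx => (hp x hx).2
  · intro s t hs hsD ht hts
    rw [hFK, hFK]
    refine pow_mul_measureReal_le_of_mapsTo_homothety μ (a := a) (by positivity) (hfinite _) ?_
    rintro x ⟨hx, hxK⟩
    have hx : p x ≤ s := hx
    refine ⟨?_, hstar a ha x hxK _ (by positivity) (div_le_one_of_le₀ hts hs.le)⟩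
    change p _ ≤ t
    rw [hhom, hpa, sub_zero, add_zero]
    calc t / s * p x ≤ t / s * s := by gcongr
      _ = t := by field_simp
  · intro s t hs hsD hst htD
    rw [hWK, hWK]
    have h0 : 0 < D - s := by linarith
    have hr : 0 ≤ (D - t) / (D - s) := div_nonneg (by linarith) h0.le
    refine pow_mul_measureReal_le_of_mapsTo_homothety μ (a := a + D • u) hr (hfinite _) ?_
    rintro x ⟨hx, hxK⟩
    have hx : s ≤ p x := hx
    refine ⟨?_, hstar _ hb x hxK _ hr (div_le_one_of_le₀ (by linarith) h0.le)⟩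
    change t ≤ p _
    rw [hhom, hpb]
    have : (D - t) / (D - s) * (D - p x) ≤ (D - t) / (D - s) * (D - s) := by gcongr
    rw [div_mul_cancel₀ _ h0.ne'] at this
    linarith

/-- Projecting onto a line strictly decreases the mean distance in dimension at least two; this
is what makes the lower bound strict. -/
theorem integral_abs_inner_lt_integral_norm {K : Set E} (hK : IsCompact K)
    (hi : (interior K).Nonempty) (hd : 2 ≤ finrank ℝ E) {u : E} (hu : ‖u‖ = 1) :
    ∫ x in K, ∫ y in K, |⟪u, x - y⟫| ∂μ ∂μ < ∫ x in K, ∫ y in K, ‖x - y‖ ∂μ ∂μ := by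
  have hfin : IsFiniteMeasure (μ.restrict K) := ⟨by
    rw [Measure.restrict_apply_univ]; exact hK.measure_lt_top⟩
  set ν := (μ.restrict K).prod (μ.restrict K) with hν
  have hνK : ν = (μ.prod μ).restrict (K ×ˢ K) := Measure.prod_restrict _ _
  have hint : ∀ f : E × E → ℝ, Continuous f → Integrable f ν := by
    intro f hf
    rw [hνK]
    exact hf.continuousOn.integrableOn_compact (hK.prod hK)
  have c1 : Continuous fun z : E × E => |⟪u, z.1 - z.2⟫| := by fun_prop
  have c2 : Continuous fun z : E × E => ‖z.1 - z.2‖ := by fun_prop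
  rw [← integral_prod _ (hint _ c1), ← integral_prod _ (hint _ c2), ← sub_pos,
    ← integral_sub (hint _ c2) (hint _ c1)]
  have hnn : ∀ z : E × E, 0 ≤ ‖z.1 - z.2‖ - |⟪u, z.1 - z.2⟫| := by
    intro z
    have := abs_real_inner_le_norm u (z.1 - z.2)
    rw [hu, one_mul] at this
    linarith
  rw [integral_pos_iff_support_of_nonneg hnn ((hint _ c2).sub (hint _ c1))]
  set S := Function.support fun z : E × E => ‖z.1 - z.2‖ - |⟪u, z.1 - z.2⟫| with hS
  have hSo : IsOpen S := (c2.sub c1).isOpen_support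
  obtain ⟨x, hx⟩ := hi
  -- in dimension at least two there is a direction orthogonal to `u`
  obtain ⟨v, hv0, hv⟩ : ∃ v : E, v ≠ 0 ∧ ⟪u, v⟫ = 0 := by
    by_contra! hcon
    have h1 : (ℝ ∙ u)ᗮ = ⊥ := by
      rw [Submodule.eq_bot_iff]
      intro v hv
      rw [Submodule.mem_orthogonal_singleton_iff_inner_right] at hv
      by_contra hv0
      exact hcon v hv0 hv
    have h2 := Submodule.finrank_add_finrank_orthogonal (ℝ ∙ u)
    rw [h1, finrank_bot, finrank_span_singleton (by rintro rfl; simp at hu)] at h2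
    omega
  obtain ⟨ε, hε, hxε⟩ : ∃ ε : ℝ, ε ≠ 0 ∧ x + ε • v ∈ interior K := by
    have hcont : ContinuousAt (fun ε : ℝ => x + ε • v) 0 := by fun_prop
    have h1 : ∀ᶠ ε : ℝ in 𝓝 0, x + ε • v ∈ interior K :=
      hcont.eventually_mem (by simpa using isOpen_interior.mem_nhds hx)
    obtain ⟨ε, h2, h3⟩ := ((h1.filter_mono nhdsWithin_le_nhds).and
      (self_mem_nhdsWithin (a := (0 : ℝ)) (s := Ioi 0))).exists
    exact ⟨ε, (show (0 : ℝ) < ε from h3).ne', h2⟩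
  have hpos : 0 < (μ.prod μ) (S ∩ (interior K ×ˢ interior K)) := by
    refine (hSo.inter (isOpen_interior.prod isOpen_interior)).measure_pos _
      ⟨(x + ε • v, x), ?_, hxε, hx⟩
    simp [hS, inner_smul_right, hv, hε, hv0]
  rw [hνK, Measure.restrict_apply hSo.measurableSet]
  exact hpos.trans_le (measure_mono (inter_subset_inter_right _
    (prod_mono interior_subset interior_subset)))

theorem diam_pos_of_measureReal_pos [Nontrivial E] {K : Set E} (hK : Bornology.IsBounded K)
    (hV : 0 < μ.real K) : 0 < Metric.diam K := by
  refine Metric.diam_nonneg.lt_of_ne fun h => hV.ne' ?_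
  have hs : K.Subsingleton := fun x hx y hy =>
    dist_le_zero.1 ((Metric.dist_le_diam_of_mem hK hx hy).trans h.ge)
  rw [measureReal_def, hs.measure_zero, ENNReal.toReal_zero]

/-- The lower bound for the mean distance, with volume and diameter multiplied out. -/
theorem double_cone_lt_integral_norm {K : Set E} (hK : IsCompact K) (hc : Convex ℝ K)
    (hi : (interior K).Nonempty) (hd : 2 ≤ finrank ℝ E) :
    (3 * (finrank ℝ E : ℝ) + 1) / (2 * ((finrank ℝ E : ℝ) + 1) * (2 * (finrank ℝ E : ℝ) + 1)) *
      Metric.diam K * μ.real K ^ 2 < ∫ x in K, ∫ y in K, ‖x - y‖ ∂μ ∂μ := by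
  have : Nontrivial E := Module.nontrivial_of_finrank_pos (R := ℝ) (by omega)
  have hV : 0 < μ.real K := ENNReal.toReal_pos
    ((isOpen_interior.measure_pos μ hi).trans_le (measure_mono interior_subset)).ne'
    hK.measure_lt_top.ne
  have hD : 0 < Metric.diam K := diam_pos_of_measureReal_pos μ hK.isBounded hV
  have hne : K.Nonempty := hi.mono interior_subset
  obtain ⟨⟨a, b⟩, ⟨ha, hb⟩, hab⟩ := (hK.prod hK).exists_isMaxOn (hne.prod hne)
    (continuous_dist (α := E)).continuousOn
  have hmax : ∀ x ∈ K, ∀ y ∈ K, dist x y ≤ dist a b := fun x hx y hy => hab (mk_mem_prod hx hy)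
  have hDe : Metric.diam K = dist a b := le_antisymm
    (Metric.diam_le_of_forall_dist_le dist_nonneg hmax)
    (Metric.dist_le_diam_of_mem hK.isBounded ha hb)
  rw [hDe] at hD ⊢
  set D := dist a b with hDdef
  have hnorm : ‖b - a‖ = D := by rw [hDdef, dist_eq_norm, norm_sub_rev]
  set u : E := D⁻¹ • (b - a) with hu
  have hu1 : ‖u‖ = 1 := by
    rw [hu, norm_smul, hnorm, norm_inv, Real.norm_of_nonneg hD.le, inv_mul_cancel₀ hD.ne']
  have hb' : a + D • u = b := by
    rw [hu, smul_inv_smul₀ hD.ne']; abel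
  have hle : ∀ z : E, ⟪u, z⟫ ≤ ‖z‖ := fun z => by
    simpa [hu1] using real_inner_le_norm u z
  refine (double_cone_le_integral_abs_inner μ hK hc hV hD hu1 ha (by rwa [hb'])
    fun x hx => ?_).trans_lt (integral_abs_inner_lt_integral_norm μ hK hi hd hu1)
  constructor
  · have h1 := hle (b - x)
    have h2 : ‖b - x‖ ≤ D := by rw [← dist_eq_norm]; exact hmax b hb x hx
    have h3 : ⟪u, b - x⟫ + ⟪u, x - a⟫ = D := by
      rw [← inner_add_right, sub_add_sub_cancel, hu, real_inner_smul_left,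
        real_inner_self_eq_norm_sq, hnorm]
      field_simp
    linarith
  · refine (hle _).trans ?_
    rw [← dist_eq_norm]; exact hmax x hx a ha

end Projection

/-! ### Convexity of the covariogram along rays -/

/-- A decreasing function on `[0, ∞)` whose increments over steps of equal length shrink is
convex; only the chord that ends at a zero `c` of `f` is needed. Compare `f` at the points
`b ± k h` with `h = (c - b) / N`, and let `N → ∞`. -/
theorem chord_le_of_antitone_increments {f : ℝ → ℝ} {a b c : ℝ} (ha : 0 ≤ a) (hab : a ≤ b)
    (hbc : b < c) (hf : ∀ r s, 0 ≤ r → r ≤ s → f s ≤ f r)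
    (hinc : ∀ r s h, 0 ≤ r → r ≤ s → 0 ≤ h → f s - f (s + h) ≤ f r - f (r + h)) (hc : f c = 0) :
    (c - a) * f b ≤ (c - b) * f a := by
  have hcb : 0 < c - b := sub_pos.2 hbc
  have hfb : 0 ≤ f b := hc ▸ hf b c (ha.trans hab) hbc.le
  suffices h : ∀ N : ℕ, 0 < N → (b - a) * f b ≤ (c - b) * (f a - f b) + (c - b) * f b / N by
    have hlim : Tendsto (fun N : ℕ => (c - b) * (f a - f b) + (c - b) * f b / N) atTop
        (𝓝 ((c - b) * (f a - f b) + 0)) :=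
      tendsto_const_nhds.add (tendsto_const_div_atTop_nhds_zero_nat _)
    have := ge_of_tendsto hlim (by
      filter_upwards [eventually_gt_atTop 0] with N hN using h N hN)
    linarith
  intro N hN
  have hN' : (0 : ℝ) < N := by exact_mod_cast hN
  set h := (c - b) / N with hh
  have h0 : 0 < h := div_pos hcb hN'
  set δ := f b - f (b + h)
  have up : ∀ n : ℕ, f b - f (b + n * h) ≤ n * δ := by
    intro n
    induction n with
    | zero => simp
    | succ n ih =>
      have := hinc b (b + n * h) h (ha.trans hab) (by nlinarith [n.cast_nonneg (α := ℝ)]) h0.le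
      push_cast
      rw [show b + (n + 1) * h = b + n * h + h by ring]
      linarith
  have down : ∀ n : ℕ, n * h ≤ b → n * δ ≤ f (b - n * h) - f b := by
    intro n
    induction n with
    | zero => simp
    | succ n ih =>
      intro hn
      push_cast at hn ⊢
      have h1 := hinc (b - (n + 1) * h) b h (by linarith)
        (by nlinarith [n.cast_nonneg (α := ℝ)]) h0.le
      rw [show b - (n + 1) * h + h = b - n * h by ring] at h1
      have := ih (by linarith)
      linarith
  have h1 : f b ≤ N * δ := by
    have := up N
    have e : b + N * h = c := by rw [hh, mul_div_cancel₀ _ hN'.ne', add_sub_cancel]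
    rwa [e, hc, sub_zero] at this
  set m := ⌊(b - a) / h⌋₊
  have hm : (m : ℝ) * h ≤ b - a := by
    rw [← le_div_iff₀ h0]
    exact Nat.floor_le (div_nonneg (sub_nonneg.2 hab) h0.le)
  have h2 : m * δ ≤ f a - f b := by
    have h3 := down m (by linarith)
    have h4 := hf a (b - m * h) ha (by linarith)
    linarith
  have h3 : (b - a) / h - 1 ≤ m := by
    have := Nat.lt_floor_add_one ((b - a) / h)
    linarith
  have h4 : ((b - a) / h - 1) * f b ≤ N * (f a - f b) := by
    calc ((b - a) / h - 1) * f b ≤ m * f b := by gcongr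
      _ ≤ m * (N * δ) := by gcongr
      _ = N * (m * δ) := by ring
      _ ≤ N * (f a - f b) := by gcongr
  have h5 := mul_le_mul_of_nonneg_left h4 h0.le
  have e1 : h * (((b - a) / h - 1) * f b) = (b - a) * f b - h * f b := by field_simp
  have e2 : h * (N * (f a - f b)) = (c - b) * (f a - f b) := by rw [hh]; field_simp
  have e3 : (c - b) * f b / N = h * f b := by rw [hh]; ring
  rw [e1, e2] at h5
  rw [e3]
  linarith

theorem add_smul_mem_of_le {E : Type*} [NormedAddCommGroup E] [NormedSpace ℝ E]
    {K : Set E} (hc : Convex ℝ K) {x u : E} {r s : ℝ} (hr : 0 ≤ r) (hrs : r ≤ s)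
    (hx : x ∈ K) (hs : x + s • u ∈ K) : x + r • u ∈ K := by
  rcases hr.eq_or_lt with rfl | hr'
  · simpa using hx
  have h0 : 0 < s := hr'.trans_le hrs
  have := hc.add_smul_mem hx hs (t := r / s) ⟨by positivity, div_le_one_of_le₀ hrs h0.le⟩
  rwa [smul_smul, div_mul_cancel₀ _ h0.ne'] at this

section Covariogram

variable {E : Type*} [NormedAddCommGroup E] [MeasurableSpace E]

/-- The covariogram of `K`: the volume of `K ∩ (K - z)`, that is, the (unnormalized) density at
`z` of the difference `y - x` of two random points of `K`. -/
noncomputable def covariogram (μ : Measure E) (K : Set E) (z : E) : ℝ :=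
  μ.real {x | x ∈ K ∧ x + z ∈ K}

theorem covariogram_nonneg (μ : Measure E) (K : Set E) (z : E) : 0 ≤ covariogram μ K z :=
  measureReal_nonneg

theorem covariogram_eq_zero (μ : Measure E) {K : Set E} (hK : Bornology.IsBounded K) {z : E}
    (hz : Metric.diam K < ‖z‖) : covariogram μ K z = 0 := by
  have : {x | x ∈ K ∧ x + z ∈ K} = ∅ := by
    rw [eq_empty_iff_forall_notMem]
    rintro x ⟨h1, h2⟩
    have := Metric.dist_le_diam_of_mem hK h2 h1
    rw [dist_eq_norm, add_sub_cancel_left] at this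
    linarith
  simp [covariogram, this]

theorem measure_covariogram_set_ne_top (μ : Measure E) [IsFiniteMeasureOnCompacts μ] {K : Set E}
    (hK : IsCompact K) (z : E) : μ {x | x ∈ K ∧ x + z ∈ K} ≠ ⊤ :=
  ((measure_mono fun _ hx => hx.1).trans_lt hK.measure_lt_top).ne

theorem covariogram_le (μ : Measure E) [IsFiniteMeasureOnCompacts μ] {K : Set E}
    (hK : IsCompact K) (z : E) : covariogram μ K z ≤ μ.real K :=
  measureReal_mono (fun _ hx => hx.1) hK.measure_lt_top.ne

theorem measurableSet_covariogram_set [BorelSpace E] {K : Set E} (hK : IsCompact K) (z : E) :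
    MeasurableSet {x | x ∈ K ∧ x + z ∈ K} :=
  hK.measurableSet.inter ((measurable_add_const z) hK.measurableSet)

variable [NormedSpace ℝ E] (μ : Measure E)

theorem covariogram_smul_antitone [IsFiniteMeasureOnCompacts μ] {K : Set E} (hK : IsCompact K)
    (hc : Convex ℝ K) (u : E) {r s : ℝ} (hr : 0 ≤ r) (hrs : r ≤ s) :
    covariogram μ K (s • u) ≤ covariogram μ K (r • u) :=
  measureReal_mono (fun _ hx => ⟨hx.1, add_smul_mem_of_le hc hr hrs hx.1 hx.2⟩)
    (measure_covariogram_set_ne_top μ hK _)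

theorem covariogram_smul_sub_eq [BorelSpace E] [IsFiniteMeasureOnCompacts μ]
    {K : Set E} (hK : IsCompact K) (hc : Convex ℝ K) (u : E) {r h : ℝ} (hr : 0 ≤ r)
    (hh : 0 ≤ h) :
    covariogram μ K (r • u) - covariogram μ K ((r + h) • u) =
      μ.real {x | x ∈ K ∧ x + r • u ∈ K ∧ x + (r + h) • u ∉ K} := by
  have hsub : {x | x ∈ K ∧ x + (r + h) • u ∈ K} ⊆ {x | x ∈ K ∧ x + r • u ∈ K} := fun x hx =>
    ⟨hx.1, add_smul_mem_of_le hc hr (le_add_of_nonneg_right hh) hx.1 hx.2⟩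
  rw [covariogram, covariogram, ← measureReal_sdiff hsub
    (measurableSet_covariogram_set hK _) (measure_covariogram_set_ne_top μ hK _)]
  congr 1
  ext x
  simp only [Set.mem_sdiff, mem_ofPred_eq]
  tauto

variable [BorelSpace E] [μ.IsAddHaarMeasure]

/-- Along a ray the covariogram falls ever more slowly: translation by `(s - r) u` carries the
points of `K` that leave `K` between the times `s` and `s + h` to points that leave between `r`
and `r + h`. -/
theorem covariogram_smul_increments {K : Set E} (hK : IsCompact K) (hc : Convex ℝ K) (u : E)
    {r s h : ℝ} (hr : 0 ≤ r) (hrs : r ≤ s) (hh : 0 ≤ h) :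
    covariogram μ K (s • u) - covariogram μ K ((s + h) • u) ≤
      covariogram μ K (r • u) - covariogram μ K ((r + h) • u) := by
  rw [covariogram_smul_sub_eq μ hK hc u (hr.trans hrs) hh, covariogram_smul_sub_eq μ hK hc u hr hh]
  set A := {x | x ∈ K ∧ x + r • u ∈ K ∧ x + (r + h) • u ∉ K}
  have h1 : μ.real A = μ.real ((fun x => x + (s - r) • u) ⁻¹' A) := by
    rw [measureReal_def, measureReal_def, measure_preimage_add_right]
  rw [h1]
  refine measureReal_mono ?_ ?_
  · rintro x ⟨hx1, hx2, hx3⟩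
    refine ⟨add_smul_mem_of_le hc (sub_nonneg.2 hrs) (sub_le_self _ hr) hx1 hx2, ?_, ?_⟩
    · rwa [add_assoc, ← add_smul, sub_add_cancel]
    · rwa [add_assoc, ← add_smul, ← add_assoc, sub_add_cancel]
  · rw [measure_preimage_add_right]
    exact ((measure_mono fun _ hx => hx.1).trans_lt hK.measure_lt_top).ne

theorem covariogram_chord {K : Set E} (hK : IsCompact K) (hc : Convex ℝ K) {D : ℝ}
    (hD : Metric.diam K < D) {u : E} (hu : ‖u‖ = 1) {a b : ℝ} (ha : 0 ≤ a) (hab : a ≤ b)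
    (hb : b < D) :
    (D - a) * covariogram μ K (b • u) ≤ (D - b) * covariogram μ K (a • u) :=
  chord_le_of_antitone_increments (f := fun r => covariogram μ K (r • u)) ha hab hb
    (fun _ _ hr hrs => covariogram_smul_antitone μ hK hc u hr hrs)
    (fun _ _ _ hr hrs hh => covariogram_smul_increments μ hK hc u hr hrs hh)
    (covariogram_eq_zero μ hK.isBounded (by
      rwa [norm_smul, hu, mul_one, Real.norm_of_nonneg (by linarith)]))

/-- On the ray through `z`, compare the convex covariogram with the chord through its values at
the radii `q` and `D`: it lies above the chord before `q` and below it after `q`, which the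
factor `q - ‖z‖` turns into one inequality. The truncation by `max` is the vanishing of the
covariogram beyond `D`. -/
theorem segment_profile_le_covariogram {K : Set E} (hK : IsCompact K) (hc : Convex ℝ K) {q D : ℝ}
    (hD : Metric.diam K < D) (hq : 0 ≤ q) (hqD : q < D) {z : E} (hz : z ≠ 0) :
    (q - ‖z‖) * max (D - ‖z‖) 0 * (covariogram μ K (q • ‖z‖⁻¹ • z) / (D - q)) ≤
      (q - ‖z‖) * covariogram μ K z := by
  have hz0 : 0 < ‖z‖ := norm_pos_iff.2 hz
  have hu : ‖‖z‖⁻¹ • z‖ = 1 := by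
    rw [norm_smul, norm_inv, norm_norm, inv_mul_cancel₀ hz0.ne']
  have hzu : ‖z‖ • ‖z‖⁻¹ • z = z := smul_inv_smul₀ hz0.ne' z
  have hDq : 0 < D - q := sub_pos.2 hqD
  rcases le_or_gt ‖z‖ q with h | h
  · have := covariogram_chord μ hK hc hD hu hz0.le h hqD
    rw [hzu] at this
    rw [max_eq_left (by linarith), mul_assoc]
    refine mul_le_mul_of_nonneg_left ?_ (sub_nonneg.2 h)
    rw [← mul_div_assoc, div_le_iff₀ hDq]
    linarith
  · rcases lt_or_ge ‖z‖ D with h' | h'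
    · have := covariogram_chord μ hK hc hD hu hq h.le h'
      rw [hzu] at this
      rw [max_eq_left (by linarith), mul_assoc]
      refine mul_le_mul_of_nonpos_left ?_ (sub_nonpos.2 h.le)
      rw [← mul_div_assoc, le_div_iff₀ hDq]
      linarith
    · rw [max_eq_right (by linarith), covariogram_eq_zero μ hK.isBounded (hD.trans_le h')]
      simp

/-! ### The upper bound -/

variable [FiniteDimensional ℝ E]

theorem measurable_covariogram {K : Set E} (hK : IsCompact K) : Measurable (covariogram μ K) := by
  have hm : MeasurableSet {q : E × E | q.2 ∈ K ∧ q.2 + q.1 ∈ K} :=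
    (measurable_snd hK.measurableSet).inter
      ((measurable_snd.add measurable_fst) hK.measurableSet)
  exact (measurable_measure_prodMk_left (ν := μ) hm).ennreal_toReal

theorem integral_integral_norm_sub_eq_covariogram {K : Set E} (hK : IsCompact K) {φ : ℝ → ℝ}
    (hφ : Continuous φ) :
    ∫ x in K, ∫ y in K, φ ‖x - y‖ ∂μ ∂μ = ∫ z, φ ‖z‖ * covariogram μ K z ∂μ := by
  set G : E × E → ℝ := fun q => (K ×ˢ K).indicator (fun q => φ ‖q.1 - q.2‖) q with hG
  have hGi : Integrable G (μ.prod μ) := by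
    rw [hG, integrable_indicator_iff (hK.measurableSet.prod hK.measurableSet)]
    have hcont : Continuous fun q : E × E => φ ‖q.1 - q.2‖ := by fun_prop
    exact hcont.continuousOn.integrableOn_compact (hK.prod hK)
  have hGs : Integrable (fun q : E × E => G (q.1, q.1 + q.2)) (μ.prod μ) :=
    (measurePreserving_prod_add μ μ).integrable_comp_of_integrable hGi
  calc ∫ x in K, ∫ y in K, φ ‖x - y‖ ∂μ ∂μ = ∫ x, ∫ y, G (x, y) ∂μ ∂μ := by
        rw [← integral_indicator hK.measurableSet]
        refine integral_congr_ae (Eventually.of_forall fun x => ?_)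
        by_cases hx : x ∈ K
        · simp only [indicator_of_mem hx]
          rw [← integral_indicator hK.measurableSet]
          refine integral_congr_ae (Eventually.of_forall fun y => ?_)
          by_cases hy : y ∈ K <;> simp [hG, indicator, hx, hy]
        · simp [hG, indicator, hx]
    _ = ∫ x, ∫ z, G (x, x + z) ∂μ ∂μ := by
        refine integral_congr_ae (Eventually.of_forall fun x => ?_)
        exact (integral_add_left_eq_self (fun y => G (x, y)) x).symm
    _ = ∫ z, ∫ x, G (x, x + z) ∂μ ∂μ := integral_integral_swap hGs
    _ = ∫ z, φ ‖z‖ * covariogram μ K z ∂μ := by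
        refine integral_congr_ae (Eventually.of_forall fun z => ?_)
        have e : ∀ x, G (x, x + z) = {x | x ∈ K ∧ x + z ∈ K}.indicator (fun _ => φ ‖z‖) x := by
          intro x
          by_cases hx : x ∈ K <;> by_cases hz : x + z ∈ K <;> simp [hG, indicator, hx, hz]
        simp only [e]
        rw [integral_indicator_const _ (measurableSet_covariogram_set hK z), smul_eq_mul, mul_comm]
        rfl

/-- Polar coordinates for a product of a radial function and a function of the direction. -/
theorem integral_norm_mul_direction [Nontrivial E] (h : ℝ → ℝ) (c : E → ℝ) :
    ∫ z, h ‖z‖ * c (‖z‖⁻¹ • z) ∂μ =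
      (∫ s, c s ∂μ.toSphere) * ∫ y in Ioi (0 : ℝ), y ^ (finrank ℝ E - 1) * h y := by
  calc
    ∫ z, h ‖z‖ * c (‖z‖⁻¹ • z) ∂μ =
        ∫ z : ({(0)}ᶜ : Set E), h ‖z.1‖ * c (‖z.1‖⁻¹ • z.1) ∂(μ.comap (↑)) := by
      rw [integral_subtype_comap (measurableSet_singleton _).compl
        fun x => h ‖x‖ * c (‖x‖⁻¹ • x), restrict_compl_singleton]
    _ = ∫ q, c q.1 * h q.2 ∂μ.toSphere.prod (.volumeIoiPow (finrank ℝ E - 1)) := by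
      have := μ.measurePreserving_homeomorphUnitSphereProd.integral_comp
        (Homeomorph.measurableEmbedding _)
        (fun q : Metric.sphere (0 : E) 1 × Ioi (0 : ℝ) => c q.1 * h q.2)
      rw [← this]
      simp [mul_comm]
    _ = (∫ s, c s ∂μ.toSphere) * ∫ y : Ioi (0 : ℝ), h y ∂.volumeIoiPow (finrank ℝ E - 1) :=
      integral_prod_mul (fun s : Metric.sphere (0 : E) 1 => c s) fun y : Ioi (0 : ℝ) => h y
    _ = _ := by
      congr 1
      simp only [Measure.volumeIoiPow, ENNReal.ofReal]
      rw [integral_withDensity_eq_integral_smul,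
        integral_subtype_comap measurableSet_Ioi
          fun a ↦ Real.toNNReal (a ^ (finrank ℝ E - 1)) • h a]
      · refine setIntegral_congr_fun measurableSet_Ioi fun x hx => ?_
        simp only [NNReal.smul_def, smul_eq_mul]
        rw [Real.coe_toNNReal _ (pow_nonneg hx.out.le _)]
      · exact (measurable_subtype_coe.pow_const _).real_toNNReal

/-- The radius `n / (n + 2) * D` is the mean of the density proportional to
`y ^ (n - 1) * (D - y)` on `[0, D]`. -/
theorem integral_pow_mul_segment_profile {n : ℕ} (hn : 0 < n) {D : ℝ} (hD : 0 ≤ D) :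
    ∫ y in Ioi (0 : ℝ), y ^ (n - 1) * ((n / (n + 2) * D - y) * max (D - y) 0) = 0 := by
  obtain ⟨k, rfl⟩ : ∃ k, n = k + 1 := ⟨n - 1, by omega⟩
  have h1 : ∫ y in Ioi (0 : ℝ), y ^ (k + 1 - 1) *
      ((((k + 1 : ℕ) : ℝ) / ((k + 1 : ℕ) + 2) * D - y) * max (D - y) 0) =
      ∫ y in Ioc 0 D, y ^ k * ((((k + 1 : ℕ) : ℝ) / ((k + 1 : ℕ) + 2) * D - y) * (D - y)) := by
    rw [setIntegral_eq_of_subset_of_forall_sdiff_eq_zero measurableSet_Ioi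
      (show Ioc 0 D ⊆ Ioi 0 from Ioc_subset_Ioi_self)]
    · refine setIntegral_congr_fun measurableSet_Ioc fun y hy => ?_
      simp only [add_tsub_cancel_right]
      rw [max_eq_left (sub_nonneg.2 hy.2)]
    · rintro y ⟨hy1, hy2⟩
      have : D < y := by
        by_contra hcon
        exact hy2 ⟨hy1, not_lt.1 hcon⟩
      rw [max_eq_right (by linarith), mul_zero, mul_zero]
  rw [h1, ← intervalIntegral.integral_of_le hD]
  set q : ℝ := ((k + 1 : ℕ) : ℝ) / ((k + 1 : ℕ) + 2) * D with hq
  have h2 : ∀ y : ℝ, y ^ k * ((q - y) * (D - y)) =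
      q * D * y ^ k - (q + D) * y ^ (k + 1) + y ^ (k + 2) := fun y => by ring
  simp only [h2]
  rw [intervalIntegral.integral_add (Continuous.intervalIntegrable (by fun_prop) _ _)
      (Continuous.intervalIntegrable (by fun_prop) _ _),
    intervalIntegral.integral_sub (Continuous.intervalIntegrable (by fun_prop) _ _)
      (Continuous.intervalIntegrable (by fun_prop) _ _),
    intervalIntegral.integral_const_mul, intervalIntegral.integral_const_mul, integral_pow,
    integral_pow, integral_pow, hq]
  simp only [pow_succ, mul_zero, sub_zero]
  push_cast
  field_simp
  ring

theorem integral_norm_sub_le_of_diam_lt {K : Set E} (hK : IsCompact K) (hc : Convex ℝ K)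
    (hd : 0 < finrank ℝ E) {D : ℝ} (hD : Metric.diam K < D) :
    ∫ x in K, ∫ y in K, ‖x - y‖ ∂μ ∂μ ≤
      (finrank ℝ E : ℝ) / (finrank ℝ E + 2) * D * μ.real K ^ 2 := by
  have : Nontrivial E := Module.nontrivial_of_finrank_pos (R := ℝ) hd
  set n := finrank ℝ E with hn
  have hD0 : 0 < D := Metric.diam_nonneg.trans_lt hD
  set q : ℝ := (n : ℝ) / (n + 2) * D with hq
  have hq0 : 0 ≤ q := by positivity
  have hqD : q < D := by
    have : (n : ℝ) / (n + 2) < 1 := by rw [div_lt_one (by positivity)]; linarith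
    nlinarith
  have hfin : IsFiniteMeasure (μ.restrict K) := ⟨by
    rw [Measure.restrict_apply_univ]; exact hK.measure_lt_top⟩
  have hcm := measurable_covariogram μ hK
  have hball : ∀ f : E → ℝ, Measurable f → (∃ C, ∀ z ∈ Metric.closedBall (0 : E) D, |f z| ≤ C) →
      (∀ z, z ∉ Metric.closedBall (0 : E) D → f z = 0) → Integrable f μ := by
    rintro f hf ⟨C, hC⟩ h0
    rw [← integrableOn_iff_integrable_of_support_subset (s := Metric.closedBall (0 : E) D)]
    · exact IntegrableOn.of_bound (isCompact_closedBall 0 D).measure_lt_top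
        hf.aestronglyMeasurable C (by
          filter_upwards [ae_restrict_mem measurableSet_closedBall] with z hz using hC z hz)
    · exact fun z hz => by_contra fun hcon => hz (h0 z hcon)
  have hqz : ∀ z ∈ Metric.closedBall (0 : E) D, |q - ‖z‖| ≤ D := by
    intro z hz
    rw [mem_closedBall_zero_iff] at hz
    rw [abs_le]
    constructor <;> linarith [norm_nonneg z]
  have hmono : ∫ z, ((q - ‖z‖) * max (D - ‖z‖) 0) *
      (fun s => covariogram μ K (q • s) / (D - q)) (‖z‖⁻¹ • z) ∂μ ≤
      ∫ z, (q - ‖z‖) * covariogram μ K z ∂μ := by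
    refine integral_mono_ae (hball _ ?_ ⟨D * D * (μ.real K / (D - q)), ?_⟩ ?_)
      (hball _ ?_ ⟨D * μ.real K, ?_⟩ ?_) ?_
    · have : Measurable fun z : E => q • ‖z‖⁻¹ • z := by fun_prop
      have := hcm.comp this
      simp only [Function.comp_def] at this
      fun_prop
    · intro z hz
      rw [abs_mul, abs_mul, abs_of_nonneg (le_max_right (D - ‖z‖) 0), abs_of_nonneg
        (div_nonneg (covariogram_nonneg _ _ _) (by linarith))]
      have h1 : max (D - ‖z‖) 0 ≤ D := max_le (by linarith [norm_nonneg z]) hD0.le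
      have h2 : covariogram μ K (q • ‖z‖⁻¹ • z) / (D - q) ≤ μ.real K / (D - q) :=
        div_le_div_of_nonneg_right (covariogram_le μ hK _) (by linarith)
      exact mul_le_mul (mul_le_mul (hqz z hz) h1 (le_max_right _ _) hD0.le) h2
        (div_nonneg (covariogram_nonneg _ _ _) (by linarith)) (by positivity)
    · intro z hz
      rw [mem_closedBall_zero_iff, not_le] at hz
      rw [max_eq_right (by linarith), mul_zero, zero_mul]
    · fun_prop
    · intro z hz
      rw [abs_mul, abs_of_nonneg (covariogram_nonneg _ _ _)]
      exact mul_le_mul (hqz z hz) (covariogram_le μ hK _) (covariogram_nonneg _ _ _) hD0.le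
    · intro z hz
      rw [mem_closedBall_zero_iff, not_le] at hz
      rw [covariogram_eq_zero μ hK.isBounded (hD.trans hz), mul_zero]
    · have h0 : ∀ᵐ z ∂μ, z ≠ 0 := by
        rw [ae_iff]; simp
      filter_upwards [h0] with z hz
      exact segment_profile_le_covariogram μ hK hc hD hq0 hqD hz
  have hint : Integrable (fun p : E × E => ‖p.1 - p.2‖) ((μ.restrict K).prod (μ.restrict K)) := by
    rw [Measure.prod_restrict]
    have hcont : Continuous fun q : E × E => ‖q.1 - q.2‖ := by fun_prop
    exact hcont.continuousOn.integrableOn_compact (hK.prod hK)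
  have hsplit : ∫ x in K, ∫ y in K, (q - ‖x - y‖) ∂μ ∂μ =
      q * μ.real K ^ 2 - ∫ x in K, ∫ y in K, ‖x - y‖ ∂μ ∂μ := by
    rw [← integral_prod (fun p : E × E => ‖p.1 - p.2‖) hint,
      ← integral_prod (fun p : E × E => q - ‖p.1 - p.2‖) ((integrable_const q).sub hint),
      integral_sub (integrable_const q) hint, integral_const, ← univ_prod_univ,
      measureReal_prod_prod, measureReal_restrict_apply_univ, smul_eq_mul]
    ring
  rw [integral_norm_mul_direction μ (fun y => (q - y) * max (D - y) 0)
      (fun s => covariogram μ K (q • s) / (D - q)),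
    integral_pow_mul_segment_profile hd hD0.le, mul_zero,
    ← integral_integral_norm_sub_eq_covariogram μ hK (φ := fun r => q - r) (by fun_prop),
    hsplit] at hmono
  linarith

/-- The mean distance is at most `d / (d + 2)` times the diameter. This is stronger than the
bound with Gamma functions, by `div_add_two_lt_Gamma_ratio`. -/
theorem integral_norm_sub_le_diam {K : Set E} (hK : IsCompact K) (hc : Convex ℝ K)
    (hd : 0 < finrank ℝ E) :
    ∫ x in K, ∫ y in K, ‖x - y‖ ∂μ ∂μ ≤
      (finrank ℝ E : ℝ) / (finrank ℝ E + 2) * Metric.diam K * μ.real K ^ 2 := by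
  have hlim : Tendsto (fun D : ℝ => (finrank ℝ E : ℝ) / (finrank ℝ E + 2) * D * μ.real K ^ 2)
      (𝓝[>] (Metric.diam K)) (𝓝 _) :=
    ((continuous_const.mul continuous_id).mul continuous_const).continuousWithinAt.tendsto
  refine ge_of_tendsto hlim ?_
  filter_upwards [self_mem_nhdsWithin] with D hD
  exact integral_norm_sub_le_of_diam_lt μ hK hc hd hD

end Covariogram

/-! ### A bound for a ratio of Gamma functions -/

/-- Log-convexity of the Gamma function at `x - 1 / 2`, `x`, `x + 1 / 2`. -/
theorem sqrt_le_Gamma_ratio {x : ℝ} (hx : 1 / 2 < x) :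
    √(x - 1 / 2) ≤ Real.Gamma (x + 1 / 2) / Real.Gamma x := by
  have hG : 0 < Real.Gamma x := Real.Gamma_pos_of_pos (by linarith)
  have h1 : 0 < Real.Gamma (x + 1 / 2) := Real.Gamma_pos_of_pos (by linarith)
  have h2 : 0 < Real.Gamma (x - 1 / 2) := Real.Gamma_pos_of_pos (by linarith)
  have h := Real.Gamma_mul_add_mul_le_rpow_Gamma_mul_rpow_Gamma (s := x - 1 / 2) (t := x + 1 / 2)
    (a := 1 / 2) (b := 1 / 2) (by linarith) (by linarith) (by norm_num) (by norm_num) (by norm_num)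
  rw [show 1 / 2 * (x - 1 / 2) + 1 / 2 * (x + 1 / 2) = x by ring, ← Real.sqrt_eq_rpow,
    ← Real.sqrt_eq_rpow, ← Real.sqrt_mul h2.le] at h
  have hrec : Real.Gamma (x + 1 / 2) = (x - 1 / 2) * Real.Gamma (x - 1 / 2) := by
    rw [← Real.Gamma_add_one (by linarith)]
    congr 1; ring
  rw [le_div_iff₀ hG]
  have hx' : 0 ≤ x - 1 / 2 := by linarith
  calc √(x - 1 / 2) * Real.Gamma x
      ≤ √(x - 1 / 2) * √(Real.Gamma (x - 1 / 2) * Real.Gamma (x + 1 / 2)) := by gcongr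
    _ = √(Real.Gamma (x + 1 / 2) ^ 2) := by
        rw [← Real.sqrt_mul hx', ← mul_assoc, ← hrec, sq]
    _ = Real.Gamma (x + 1 / 2) := Real.sqrt_sq h1.le

/-- The square-root bound for the ratio of Gamma functions is too weak for `d = 2` and `d = 3`,
where the ratio is evaluated: the claims are `1 / 2 < π / 6` and `3 / 5 < 2 / 3`. -/
theorem div_add_two_lt_Gamma_ratio {d : ℕ} (hd : 2 ≤ d) :
    (d : ℝ) / (d + 2) < √Real.pi / 3 *
      (Real.Gamma (((d : ℝ) + 1) / 2) / Real.Gamma ((d : ℝ) / 2)) := by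
  have hpi := Real.pi_gt_three
  have hs := Real.mul_self_sqrt Real.pi_pos.le
  have hs0 : 0 < √Real.pi := Real.sqrt_pos.2 Real.pi_pos
  have h32 : Real.Gamma (3 / 2) = √Real.pi / 2 := by
    rw [show (3 / 2 : ℝ) = 1 / 2 + 1 by norm_num, Real.Gamma_add_one (by norm_num),
      Real.Gamma_one_half_eq]
    ring
  obtain rfl | rfl | h4 : d = 2 ∨ d = 3 ∨ 4 ≤ d := by omega
  · norm_num [h32]
    nlinarith
  · norm_num [h32, Real.Gamma_two]
    field_simp
    norm_num
  · have h4' : (4 : ℝ) ≤ d := by exact_mod_cast h4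
    have h := sqrt_le_Gamma_ratio (x := (d : ℝ) / 2) (by linarith)
    rw [← add_div, ← sub_div] at h
    refine lt_of_lt_of_le ?_ (mul_le_mul_of_nonneg_left h (by positivity))
    rw [div_mul_eq_mul_div, ← Real.sqrt_mul Real.pi_pos.le, lt_div_iff₀ (by norm_num)]
    apply Real.lt_sqrt_of_sq_lt
    rw [div_mul_eq_mul_div, div_pow, div_lt_iff₀ (by positivity)]
    have h5 : (0 : ℝ) < (d - 1) * (d + 2) ^ 2 := mul_pos (by linarith) (by positivity)
    have h6 : (0 : ℝ) ≤ (d - 4) * d ^ 2 := mul_nonneg (by linarith) (by positivity)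
    nlinarith

/-! ### The thin simplex -/

theorem EuclideanSpace.sum_single_eq {ι : Type*} [Fintype ι] [DecidableEq ι]
    (x : EuclideanSpace ℝ ι) : ∑ i, EuclideanSpace.single i (x i) = x := by
  ext j
  simp [Pi.single_apply]

theorem EuclideanSpace.norm_le_sum_abs {ι : Type*} [Fintype ι] (x : EuclideanSpace ℝ ι) :
    ‖x‖ ≤ ∑ i, |x i| := by
  classical
  conv_lhs => rw [← EuclideanSpace.sum_single_eq x]
  exact (norm_sum_le _ _).trans_eq (Finset.sum_congr rfl fun i _ => by simp)

section ThinSimplex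

variable {d : ℕ} [NeZero d] {δ : ℝ}

theorem mem_thinSimplex_iff (hδ : 0 < δ) {x : EuclideanSpace ℝ (Fin d)} :
    x ∈ thinSimplex d δ ↔
      (∀ i, i ≠ 0 → 0 ≤ x i) ∧ |x 0| + (∑ i ∈ Finset.univ.erase 0, x i) / δ ≤ 1 := by
  constructor
  · intro hx
    refine convexHull_min (t := {x : EuclideanSpace ℝ (Fin d) | (∀ i, i ≠ 0 → 0 ≤ x i) ∧
      |x 0| + (∑ i ∈ Finset.univ.erase 0, x i) / δ ≤ 1}) ?_ ?_ hx
    · rintro y ((rfl | rfl) | ⟨i, hi, rfl⟩)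
      · refine ⟨fun j hj => by simp [hj], ?_⟩
        rw [Finset.sum_eq_zero fun j hj => by simp [Finset.ne_of_mem_erase hj]]
        simp
      · refine ⟨fun j hj => by simp [hj], ?_⟩
        rw [Finset.sum_eq_zero fun j hj => by simp [Finset.ne_of_mem_erase hj]]
        simp
      · refine ⟨fun j _ => ?_, ?_⟩
        · by_cases h : j = i <;> simp [h, hδ.le]
        · rw [Finset.sum_eq_single_of_mem i (by simp [hi]) fun j _ hj => by simp [hj]]
          simp [hi.symm, hδ.ne']
    · rintro y ⟨hy1, hy2⟩ z ⟨hz1, hz2⟩ a b ha hb hab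
      refine ⟨fun i hi => ?_, ?_⟩
      · have h1 := mul_nonneg ha (hy1 i hi)
        have h2 := mul_nonneg hb (hz1 i hi)
        simpa using add_nonneg h1 h2
      · simp only [PiLp.add_apply, PiLp.smul_apply, smul_eq_mul, Finset.sum_add_distrib,
          ← Finset.mul_sum, add_div, mul_div_assoc]
        have h1 : |a * y 0 + b * z 0| ≤ a * |y 0| + b * |z 0| := by
          refine (abs_add_le _ _).trans_eq ?_
          rw [abs_mul, abs_mul, abs_of_nonneg ha, abs_of_nonneg hb]
        have h2 := mul_le_mul_of_nonneg_left hy2 ha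
        have h3 := mul_le_mul_of_nonneg_left hz2 hb
        linarith
  · rintro ⟨hx1, hx2⟩
    set s := 1 - (∑ i ∈ Finset.univ.erase 0, x i) / δ with hs
    have hxs : |x 0| ≤ s := by linarith
    have hs0 : 0 ≤ s := (abs_nonneg _).trans hxs
    have hconv : Convex ℝ (thinSimplex d δ) := convex_convexHull ℝ _
    -- `x` is a combination of `(x 0 / s) e₁`, a point of the segment `[-e₁, e₁]`, and of the
    -- `δ eᵢ`; if `s = 0` then `x 0 = 0`, and the junk value `x 0 / s = 0` is the right one
    set w : Fin d → ℝ := fun i => if i = 0 then s else x i / δ with hw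
    set z : Fin d → EuclideanSpace ℝ (Fin d) := fun i =>
      if i = 0 then EuclideanSpace.single 0 (x 0 / s) else δ • EuclideanSpace.single i 1 with hz
    have hwz : ∀ i, w i • z i = EuclideanSpace.single i (x i) := by
      intro i
      by_cases hi : i = 0
      · subst hi
        rcases hs0.eq_or_lt with h0 | h0
        · have : x 0 = 0 := by
            rw [← h0] at hxs
            exact abs_nonpos_iff.1 hxs
          ext j
          simp [hw, this, ← h0]
        · ext j
          by_cases hj : j = 0
          · subst hj; simp [hw, hz, mul_div_cancel₀ _ h0.ne']
          · simp [hw, hz, hj]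
      · ext j
        by_cases hj : j = i
        · subst hj; simp [hw, hz, hi, hδ.ne']
        · simp [hw, hz, hi, hj]
    have hsum : ∑ i, w i • z i = x := by
      simp only [hwz, EuclideanSpace.sum_single_eq]
    rw [← hsum]
    refine hconv.sum_mem (fun i _ => ?_) ?_ fun i _ => ?_
    · by_cases hi : i = 0
      · simp [hw, hi, hs0]
      · simp only [hw, hi, if_false]
        exact div_nonneg (hx1 i hi) hδ.le
    · rw [← Finset.add_sum_erase _ _ (Finset.mem_univ (0 : Fin d)),
        Finset.sum_congr rfl fun i hi => by
          simp only [hw, Finset.ne_of_mem_erase hi, if_false]; rfl,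
        ← Finset.sum_div]
      simp [hw, hs]
    · by_cases hi : i = 0
      · have h1 : |x 0 / s| ≤ 1 := by
          rw [abs_div, abs_of_nonneg hs0]
          exact div_le_one_of_le₀ hxs hs0
        rw [abs_le] at h1
        have hp : (EuclideanSpace.single 0 1 : EuclideanSpace ℝ (Fin d)) ∈ thinSimplex d δ :=
          subset_convexHull ℝ _ (Or.inl (Or.inl rfl))
        have hm : -(EuclideanSpace.single 0 1 : EuclideanSpace ℝ (Fin d)) ∈ thinSimplex d δ :=
          subset_convexHull ℝ _ (Or.inl (Or.inr rfl))
        have := hconv hp hm (a := (1 + x 0 / s) / 2) (b := (1 - x 0 / s) / 2) (by linarith)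
          (by linarith) (by ring)
        convert this using 1
        simp only [hz, hi, if_true]
        ext j
        by_cases hj : j = 0
        · subst hj; simp; ring
        · simp [hj]
      · simp only [hz, hi, if_false]
        exact subset_convexHull ℝ _ (Or.inr ⟨i, hi, rfl⟩)

theorem isConvexBody_thinSimplex (hδ : 0 < δ) : IsConvexBody (thinSimplex d δ) where
  isCompact := by
    refine Set.Finite.isCompact_convexHull (𝕜 := ℝ) ?_
    refine Set.Finite.union (Set.toFinite _) (Set.Finite.subset (Set.finite_range
      fun i : Fin d => δ • (EuclideanSpace.single i 1 : EuclideanSpace ℝ (Fin d))) ?_)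
    rintro x ⟨i, -, rfl⟩
    exact ⟨i, rfl⟩
  convex := convex_convexHull ℝ _
  interior_nonempty := by
    set U : Set (EuclideanSpace ℝ (Fin d)) := (⋂ i ∈ {i : Fin d | i ≠ 0}, {x | 0 < x i}) ∩
      {x | |x 0| + (∑ i ∈ Finset.univ.erase 0, x i) / δ < 1} with hU
    have hUo : IsOpen U := by
      refine IsOpen.inter ((Set.toFinite _).isOpen_biInter fun i _ => ?_) ?_
      · exact isOpen_lt continuous_const (by fun_prop)
      · exact isOpen_lt (by fun_prop) continuous_const
    have hUK : U ⊆ thinSimplex d δ := by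
      rintro x ⟨h1, h2⟩
      rw [mem_thinSimplex_iff hδ]
      exact ⟨fun i hi => le_of_lt (Set.mem_iInter₂.1 h1 i hi), le_of_lt h2⟩
    refine Set.Nonempty.mono (interior_maximal hUK hUo) ?_
    have hd0 : (0 : ℝ) < d := by exact_mod_cast NeZero.pos d
    refine ⟨WithLp.toLp 2 fun i => if i = 0 then 0 else δ / (2 * d), ?_, ?_⟩
    · refine Set.mem_iInter₂.2 fun i hi => ?_
      have hi : i ≠ 0 := hi
      have : 0 < δ / (2 * d) := by positivity
      simpa [hi] using this
    · change |if (0 : Fin d) = 0 then (0 : ℝ) else δ / (2 * d)| +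
        (∑ i ∈ Finset.univ.erase 0, if i = (0 : Fin d) then (0 : ℝ) else δ / (2 * d)) / δ < 1
      have hle : (∑ i ∈ Finset.univ.erase 0, if i = (0 : Fin d) then (0 : ℝ) else δ / (2 * d)) ≤
          ∑ _i : Fin d, δ / (2 * d) := by
        refine (Finset.sum_le_sum fun i _ => ?_).trans
          (Finset.sum_le_sum_of_subset_of_nonneg (Finset.erase_subset _ _) fun _ _ _ => by
            positivity)
        split_ifs
        · positivity
        · exact le_rfl
      rw [Finset.sum_const, Finset.card_univ, Fintype.card_fin, nsmul_eq_mul] at hle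
      rw [if_pos rfl, abs_zero, zero_add, div_lt_one hδ]
      refine hle.trans_lt ?_
      have : (d : ℝ) * (δ / (2 * d)) = δ / 2 := by field_simp
      linarith

theorem diam_thinSimplex (hδ : 0 < δ) (hδ1 : δ ≤ 1) : Metric.diam (thinSimplex d δ) = 2 := by
  have hsub : thinSimplex d δ ⊆ Metric.closedBall 0 1 := by
    refine convexHull_min ?_ (convex_closedBall _ _)
    rintro x ((rfl | rfl) | ⟨i, -, rfl⟩)
    · simp
    · simp
    · simpa [norm_smul, abs_of_pos hδ] using hδ1
  refine le_antisymm ?_ ?_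
  · have := Metric.diam_mono hsub Metric.isBounded_closedBall
    refine this.trans ((Metric.diam_closedBall zero_le_one).trans_eq (by norm_num))
  · have h1 : (EuclideanSpace.single 0 1 : EuclideanSpace ℝ (Fin d)) ∈ thinSimplex d δ :=
      subset_convexHull ℝ _ (Or.inl (Or.inl rfl))
    have h2 : -(EuclideanSpace.single 0 1 : EuclideanSpace ℝ (Fin d)) ∈ thinSimplex d δ :=
      subset_convexHull ℝ _ (Or.inl (Or.inr rfl))
    have h3 := Metric.dist_le_diam_of_mem (Metric.isBounded_closedBall.subset hsub) h1 h2
    rw [dist_eq_norm, sub_neg_eq_add, ← two_smul ℝ, norm_smul] at h3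
    simpa using h3

theorem norm_sub_le_of_mem_thinSimplex (hδ : 0 < δ) {x y : EuclideanSpace ℝ (Fin d)}
    (hx : x ∈ thinSimplex d δ) (hy : y ∈ thinSimplex d δ) :
    ‖x - y‖ ≤ |x 0 - y 0| + d * δ := by
  have hb : ∀ z ∈ thinSimplex d δ, ∀ i : Fin d, i ≠ 0 → 0 ≤ z i ∧ z i ≤ δ := by
    intro z hz i hi
    rw [mem_thinSimplex_iff hδ] at hz
    refine ⟨hz.1 i hi, ?_⟩
    have h1 : z i ≤ ∑ i ∈ Finset.univ.erase 0, z i :=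
      Finset.single_le_sum (fun j hj => hz.1 j (Finset.ne_of_mem_erase hj)) (by simp [hi])
    have h2 : (∑ i ∈ Finset.univ.erase 0, z i) / δ ≤ 1 := by linarith [hz.2, abs_nonneg (z 0)]
    rw [div_le_one hδ] at h2
    exact h1.trans h2
  refine (EuclideanSpace.norm_le_sum_abs _).trans ?_
  rw [← Finset.add_sum_erase _ _ (Finset.mem_univ (0 : Fin d))]
  refine add_le_add le_rfl ?_
  calc ∑ i ∈ Finset.univ.erase 0, |(x - y) i|
      ≤ ∑ i ∈ (Finset.univ : Finset (Fin d)).erase 0, δ := by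
        refine Finset.sum_le_sum fun i hi => ?_
        have h1 := hb x hx i (Finset.ne_of_mem_erase hi)
        have h2 := hb y hy i (Finset.ne_of_mem_erase hi)
        rw [PiLp.sub_apply, abs_le]
        constructor <;> linarith
    _ ≤ ∑ i : Fin d, δ :=
        Finset.sum_le_sum_of_subset_of_nonneg (Finset.erase_subset _ _) fun _ _ _ => hδ.le
    _ = d * δ := by simp

/-- The first coordinate on the thin simplex has the distribution of a double cone: the part
`x 0 + 1 ≤ t` with `t ≤ 1` is a homothetic copy of the half `x 0 ≤ 0`, and the simplex is
symmetric under the reflection in `x 0`. -/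
theorem integral_abs_first_coord_thinSimplex_le (hδ : 0 < δ) :
    ∫ x in thinSimplex d δ, ∫ y in thinSimplex d δ, |x 0 - y 0| ≤
      (3 * (d : ℝ) + 1) / (2 * ((d : ℝ) + 1) * (2 * (d : ℝ) + 1)) * 2 *
        volume.real (thinSimplex d δ) ^ 2 := by
  set K := thinSimplex d δ with hKdef
  have hK : IsCompact K := (isConvexBody_thinSimplex hδ).isCompact
  set V := volume.real K with hV
  have hfin : IsFiniteMeasure ((volume : Measure (EuclideanSpace ℝ (Fin d))).restrict K) := ⟨by
    rw [Measure.restrict_apply_univ]; exact hK.measure_lt_top⟩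
  set p : EuclideanSpace ℝ (Fin d) → ℝ := fun x => x 0 + 1 with hpdef
  have hpm : Measurable p := Continuous.measurable (by fun_prop)
  have hnull : ∀ t, volume {x | p x = t} = 0 := by
    intro t
    have hne : (EuclideanSpace.single 0 1 : EuclideanSpace ℝ (Fin d)) ≠ 0 := by simp
    rw [← measure_inner_eq_zero volume hne (t - 1)]
    congr 1
    ext x
    simp [hpdef, EuclideanSpace.inner_single_left, eq_sub_iff_add_eq]
  set F : ℝ → ℝ := fun t => (volume.restrict K).real {x | p x ≤ t} with hFdef
  have hFc : Continuous F := continuous_measureReal_sublevel _ hpm fun t =>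
    le_antisymm ((Measure.restrict_apply_le _ _).trans (hnull t).le) bot_le
  have hFK : ∀ t, F t = volume.real ({x | p x ≤ t} ∩ K) := fun t => by
    have m1 : MeasurableSet {x | p x ≤ t} := hpm measurableSet_Iic
    simp only [hFdef]
    rw [measureReal_restrict_apply m1]
  -- the reflection in the first coordinate preserves the simplex
  set R : EuclideanSpace ℝ (Fin d) ≃ₗᵢ[ℝ] EuclideanSpace ℝ (Fin d) :=
    LinearIsometryEquiv.piLpCongrRight 2 fun i =>
      if i = 0 then LinearIsometryEquiv.neg ℝ else LinearIsometryEquiv.refl ℝ ℝ with hR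
  have hR0 : ∀ x, R x 0 = - x 0 := fun x => by simp [hR]
  have hRi : ∀ x i, i ≠ 0 → R x i = x i := fun x i hi => by simp [hR, hi]
  have hRK : ∀ x, R x ∈ K ↔ x ∈ K := by
    intro x
    rw [hKdef, mem_thinSimplex_iff hδ, mem_thinSimplex_iff hδ, hR0, abs_neg,
      Finset.sum_congr rfl fun i hi => hRi x i (Finset.ne_of_mem_erase hi)]
    refine and_congr_left fun _ => forall₂_congr fun i hi => by rw [hRi x i hi]
  have hsymm : ∀ t, V - F t = F (2 - t) := by
    intro t
    rw [measureReal_sub_restrict_sublevel volume hK.measure_lt_top.ne hpm (hnull t), hFK]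
    have m2 : MeasurableSet ({x | p x ≤ 2 - t} ∩ K) :=
      (hpm measurableSet_Iic).inter hK.measurableSet
    rw [measureReal_def, measureReal_def, ← R.measurePreserving.measure_preimage
      m2.nullMeasurableSet]
    congr 2
    ext x
    simp only [mem_inter_iff, mem_preimage, mem_ofPred_eq, hRK, hpdef, hR0]
    refine and_congr_left fun _ => ⟨fun h => by linarith, fun h => by linarith⟩
  have hF1 : F 1 = V / 2 := by
    have := hsymm 1
    norm_num at this
    linarith
  have hle : ∀ t ∈ Ioo (0 : ℝ) 1, F t ≤ V / 2 * (t / 1) ^ d := by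
    rintro t ⟨ht0, ht1⟩
    have h : (1 / t) ^ finrank ℝ (EuclideanSpace ℝ (Fin d)) * F t ≤ F 1 := by
      rw [hFK, hFK]
      refine pow_mul_measureReal_le_of_mapsTo_homothety volume
        (a := -EuclideanSpace.single 0 1) (by positivity)
        ((measure_mono inter_subset_right).trans_lt hK.measure_lt_top).ne ?_
      rintro x ⟨hx1, hx2⟩
      have hx1 : x 0 + 1 ≤ t := hx1
      rw [hKdef, mem_thinSimplex_iff hδ] at hx2
      set y := AffineMap.homothety (-EuclideanSpace.single 0 1 : EuclideanSpace ℝ (Fin d))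
        (1 / t) x with hy
      have hy0 : y 0 = 1 / t * (x 0 + 1) - 1 := by
        simp [hy, AffineMap.homothety_apply, sub_eq_add_neg, mul_add]
      have hyi : ∀ i, i ≠ 0 → y i = 1 / t * x i := fun i hi => by
        simp [hy, AffineMap.homothety_apply, hi]
      have h1 : 1 / t * (x 0 + 1) ≤ 1 := by
        rw [one_div_mul_eq_div]; exact (div_le_one ht0).2 hx1
      refine ⟨show y 0 + 1 ≤ 1 by linarith, ?_⟩
      rw [hKdef, mem_thinSimplex_iff hδ]
      refine ⟨fun i hi => ?_, ?_⟩
      · rw [hyi i hi]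
        exact mul_nonneg (by positivity) (hx2.1 i hi)
      · rw [Finset.sum_congr rfl fun i hi => hyi i (Finset.ne_of_mem_erase hi), ← Finset.mul_sum,
          abs_of_nonpos (by linarith), hy0, mul_div_assoc]
        have h2 : (∑ i ∈ Finset.univ.erase 0, x i) / δ ≤ x 0 + 1 := by
          linarith [hx2.2, neg_abs_le (x 0)]
        have h3 := mul_le_mul_of_nonneg_left h2 (by positivity : 0 ≤ 1 / t)
        linarith
    rw [finrank_euclideanSpace_fin, hF1, one_div, inv_pow, inv_mul_le_iff₀ (by positivity)] at h
    rw [div_one, mul_comm]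
    exact h
  have hGc : Continuous fun t => F t * (V - F t) := by fun_prop
  have hleft : ∫ t in (0 : ℝ)..1, F t * (V - F t) ≤
      (3 * (d : ℝ) + 1) / (4 * ((d : ℝ) + 1) * (2 * (d : ℝ) + 1)) * 1 * V ^ 2 := by
    rw [← integral_double_cone_profile d V one_pos]
    refine intervalIntegral.integral_mono_on_of_le_Ioo zero_le_one (hGc.intervalIntegrable _ _)
      (Continuous.intervalIntegrable (by fun_prop) _ _) fun t ht => ?_
    refine mul_sub_le_mul_sub_of_le_half (hle t ht) ?_
    have : (t / 1) ^ d ≤ 1 := by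
      rw [div_one]; exact pow_le_one₀ ht.1.le ht.2.le
    have hV0 : 0 ≤ V / 2 := div_nonneg measureReal_nonneg zero_le_two
    exact mul_le_of_le_one_right hV0 this
  have hright : ∫ t in (1 : ℝ)..2, F t * (V - F t) = ∫ t in (0 : ℝ)..1, F t * (V - F t) := by
    have e := intervalIntegral.integral_comp_sub_left (a := 0) (b := 1)
      (fun t => F t * (V - F t)) 2
    norm_num at e
    rw [← e]
    refine intervalIntegral.integral_congr fun t _ => ?_
    have := hsymm t
    simp only [← this]
    ring
  have hpD : ∀ᵐ x ∂(volume.restrict K), p x ∈ Icc 0 2 := by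
    filter_upwards [ae_restrict_mem hK.measurableSet] with x hx
    rw [hKdef, mem_thinSimplex_iff hδ] at hx
    have h1 : 0 ≤ (∑ i ∈ Finset.univ.erase 0, x i) / δ :=
      div_nonneg (Finset.sum_nonneg fun i hi => hx.1 i (Finset.ne_of_mem_erase hi)) hδ.le
    have h2 : |x 0| ≤ 1 := by linarith [hx.2]
    rw [abs_le] at h2
    exact ⟨by simp only [hpdef]; linarith, by simp only [hpdef]; linarith⟩
  have h := integral_integral_abs_sub_eq (volume.restrict K) hpm zero_le_two hpD
  rw [measureReal_restrict_apply_univ] at h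
  have e : ∀ x y, |x 0 - y 0| = |p x - p y| := fun x y => by simp [hpdef]
  simp only [e]
  rw [h, ← intervalIntegral.integral_add_adjacent_intervals (hGc.intervalIntegrable 0 1)
    (hGc.intervalIntegrable 1 2), hright]
  refine (mul_le_mul_of_nonneg_left (add_le_add hleft hleft) zero_le_two).trans_eq ?_
  field_simp
  ring

theorem integral_norm_thinSimplex_le (hδ : 0 < δ) :
    ∫ x in thinSimplex d δ, ∫ y in thinSimplex d δ, ‖x - y‖ ≤
      ((3 * (d : ℝ) + 1) / (2 * ((d : ℝ) + 1) * (2 * (d : ℝ) + 1)) * 2 + d * δ) *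
        volume.real (thinSimplex d δ) ^ 2 := by
  set K := thinSimplex d δ with hKdef
  have hK : IsCompact K := (isConvexBody_thinSimplex hδ).isCompact
  have hfin : IsFiniteMeasure ((volume : Measure (EuclideanSpace ℝ (Fin d))).restrict K) := ⟨by
    rw [Measure.restrict_apply_univ]; exact hK.measure_lt_top⟩
  set ν := (volume.restrict K).prod (volume.restrict K) with hν
  have hνK : ν = (volume.prod volume).restrict (K ×ˢ K) := Measure.prod_restrict _ _
  have hint : ∀ f : EuclideanSpace ℝ (Fin d) × EuclideanSpace ℝ (Fin d) → ℝ, Continuous f →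
      Integrable f ν := by
    intro f hf
    rw [hνK]
    exact hf.continuousOn.integrableOn_compact (hK.prod hK)
  have i1 := hint (fun z => ‖z.1 - z.2‖) (by fun_prop)
  have i2 := hint (fun z => |z.1 0 - z.2 0|) (by fun_prop)
  have h := integral_abs_first_coord_thinSimplex_le (d := d) hδ
  rw [← integral_prod _ i2] at h
  rw [← integral_prod _ i1]
  have hle : ∫ z, ‖z.1 - z.2‖ ∂ν ≤ ∫ z, (|z.1 0 - z.2 0| + d * δ) ∂ν := by
    refine integral_mono_ae i1 (i2.add (integrable_const _)) ?_
    rw [hνK]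
    filter_upwards [ae_restrict_mem (hK.prod hK).measurableSet] with z hz
    exact norm_sub_le_of_mem_thinSimplex hδ hz.1 hz.2
  rw [integral_add i2 (integrable_const _), integral_const, hν, ← univ_prod_univ,
    measureReal_prod_prod, measureReal_restrict_apply_univ, smul_eq_mul] at hle
  linarith

end ThinSimplex

/-! ### The bounds for the mean distance and their sharpness -/

theorem corollary2 (d : ℕ) [NeZero d] (hd : 2 ≤ d) :
    (∀ K : Set (EuclideanSpace ℝ (Fin d)), IsConvexBody K →
      (3 * (d : ℝ) + 1) / (2 * ((d : ℝ) + 1) * (2 * (d : ℝ) + 1))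
          < meanDistance K / Metric.diam K ∧
        meanDistance K / Metric.diam K
          < Real.sqrt Real.pi / 3 *
              (Real.Gamma (((d : ℝ) + 1) / 2) / Real.Gamma ((d : ℝ) / 2))) ∧
    (∀ δ : ℝ, 0 < δ → IsConvexBody (thinSimplex d δ)) ∧
    Tendsto (fun δ : ℝ => meanDistance (thinSimplex d δ) / Metric.diam (thinSimplex d δ))
      (𝓝[>] 0) (𝓝 ((3 * (d : ℝ) + 1) / (2 * ((d : ℝ) + 1) * (2 * (d : ℝ) + 1)))) := by
  have hfr : finrank ℝ (EuclideanSpace ℝ (Fin d)) = d := finrank_euclideanSpace_fin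
  have hnt : Nontrivial (EuclideanSpace ℝ (Fin d)) :=
    Module.nontrivial_of_finrank_pos (R := ℝ) (by omega)
  have hvol : ∀ K : Set (EuclideanSpace ℝ (Fin d)), IsConvexBody K → 0 < volume.real K :=
    fun K hK => ENNReal.toReal_pos
      ((isOpen_interior.measure_pos volume hK.interior_nonempty).trans_le
        (measure_mono interior_subset)).ne' hK.isCompact.measure_lt_top.ne
  have hmean : ∀ K : Set (EuclideanSpace ℝ (Fin d)),
      meanDistance K = (∫ x in K, ∫ y in K, ‖x - y‖) / volume.real K ^ 2 := fun K => by
    rw [meanDistance, one_div_mul_eq_div]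
  have hlow : ∀ K : Set (EuclideanSpace ℝ (Fin d)), IsConvexBody K →
      (3 * (d : ℝ) + 1) / (2 * ((d : ℝ) + 1) * (2 * (d : ℝ) + 1)) <
        meanDistance K / Metric.diam K := by
    intro K hK
    have hV := hvol K hK
    have hD := diam_pos_of_measureReal_pos volume hK.isCompact.isBounded hV
    have h := double_cone_lt_integral_norm volume hK.isCompact hK.convex hK.interior_nonempty
      (by omega)
    rw [hfr] at h
    rwa [hmean, lt_div_iff₀ hD, lt_div_iff₀ (by positivity)]
  refine ⟨fun K hK => ⟨hlow K hK, ?_⟩, fun δ hδ => isConvexBody_thinSimplex hδ, ?_⟩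
  · have hV := hvol K hK
    have hD := diam_pos_of_measureReal_pos volume hK.isCompact.isBounded hV
    refine lt_of_le_of_lt ?_ (div_add_two_lt_Gamma_ratio hd)
    have h := integral_norm_sub_le_diam volume hK.isCompact hK.convex (by omega)
    rw [hfr] at h
    rwa [hmean, div_le_iff₀ hD, div_le_iff₀ (by positivity)]
  · set c := (3 * (d : ℝ) + 1) / (2 * ((d : ℝ) + 1) * (2 * (d : ℝ) + 1)) with hc
    have hlim : Tendsto (fun δ : ℝ => c + d * δ / 2) (𝓝[>] 0) (𝓝 c) := by
      have : ContinuousAt (fun δ : ℝ => c + d * δ / 2) 0 := by fun_prop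
      simpa using this.tendsto.mono_left nhdsWithin_le_nhds
    refine tendsto_of_tendsto_of_tendsto_of_le_of_le' tendsto_const_nhds hlim ?_ ?_
    · filter_upwards [self_mem_nhdsWithin] with δ hδ
      exact (hlow _ (isConvexBody_thinSimplex hδ)).le
    · filter_upwards [Ioc_mem_nhdsGT one_pos] with δ hδ
      have hV := hvol _ (isConvexBody_thinSimplex (d := d) hδ.1)
      rw [diam_thinSimplex hδ.1 hδ.2, hmean, div_le_iff₀ two_pos, div_le_iff₀ (by positivity)]
      refine (integral_norm_thinSimplex_le hδ.1).trans_eq ?_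
      ring
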